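/- Let $\Pi\subset\mathbb{R}^n$ be an irreducible reduced crystallographic root system spanning $\mathbb{R}^n$, with scalar product $\langle\cdot,\cdot\rangle$, simple roots $\Delta=\{\alpha_1,\dots,\alpha_n\}$, coroots $\alpha^\vee=2\alpha/\langle\alpha,\alpha\rangle$ and Weyl group $W$ generated by the reflections $r_i a=a-\langle\alpha_i,a\rangle\alpha_i^\vee$, $i=1,\dots,n$. Let $Q=\sum_i\mathbb{Z}\alpha_i$, $Q^\vee=\sum_i\mathbb{Z}\alpha_i^\vee$, and let $P$ and $P^\vee$ be the $\mathbb{Z}$-dual lattices of $Q^\vee$ and $Q$. Let $\omega_i^\vee$, $\omega_i$ be given by $\langle\alpha_j,\omega_i^\vee\rangle=\delta_{ij}=\langle\alpha_j^\vee,\omega_i\rangle$. Let $\xi=\sum_i m_i\alpha_i$ be the highest root of $\Pi$ and $\eta=\sum_i m_i^\vee\alpha_i^\vee$ the highest root of the dual root system $\Pi^\vee$ (with simple roots $\alpha_i^\vee$). Put $r_0a=r_\xi a+\frac{2\xi}{\langle\xi,\xi\rangle}$ and $r_0^\vee a=r_\eta a+\frac{2\eta}{\langle\eta,\eta\rangle}$,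 where $r_\xi$, $r_\eta$ are the orthogonal reflections in $\xi^\perp$, $\eta^\perp$, and $R=\{r_0,r_1,\dots,r_n\}$, $R^\vee=\{r_0^\vee,r_1,\dots,r_n\}$. The affine Weyl group $W^{\mathrm{aff}}=T(Q^\vee)\rtimes W$ is generated by $R$, the dual affine Weyl group $\widehat W^{\mathrm{aff}}=T(Q)\rtimes W$ by $R^\vee$. For an element $T(q)w$ of one of these groups, with $w\in W$ and translation part $q$, write $\psi(T(q)w)=w$ and $\tau(T(q)w)=q$. Put $$F=\Big\{\sum_{i=1}^n y_i\omega_i^\vee : y_0,\dots,y_n\ge 0,\ y_0+\sum_{i=1}^n y_im_i=1\Big\},\qquad F^\vee=\Big\{\sum_{i=1}^n z_i\omega_i : z_0,\dots,z_n\ge 0,\ z_0+\sum_{i=1}^n z_im_i^\vee=1\Big\}.$$ Let $\sigma:W\to\{\pm1\}$ be any homomorphism. (1) Let $\rho\in\mathbb{R}^n$ be an admissible dual shift, i.e. $W(\rho+P)=\rho+P$, and put $\gamma^\sigma_\rho(w)=e^{2\pi i\langle\tau(w),\rho\rangle}\,\sigma(\psi(w))$ for $w\in W^{\mathrm{aff}}$.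 With $$F^\sigma(\rho)=\{a\in F:\gamma^\sigma_\rho(\mathrm{Stab}_{W^{\mathrm{aff}}}(a))=\{1\}\},\quad R^\sigma(\rho)=\{r\in R:\gamma^\sigma_\rho(r)=-1\},\quad H^\sigma(\rho)=\{a\in F: ra=a\text{ for some }r\in R^\sigma(\rho)\}$$ one has $F^\sigma(\rho)=F\setminus H^\sigma(\rho)$. (2) Let $\rho^\vee\in\mathbb{R}^n$ be an admissible shift, i.e. $W(\rho^\vee+P^\vee)=\rho^\vee+P^\vee$, and put $\widehat\gamma^\sigma_{\rho^\vee}(w)=e^{2\pi i\langle\tau(w),\rho^\vee\rangle}\,\sigma(\psi(w))$ for $w\in\widehat W^{\mathrm{aff}}$. With $$F^{\sigma\vee}(\rho^\vee)=\{a\in F^\vee:\widehat\gamma^\sigma_{\rho^\vee}(\mathrm{Stab}_{\widehat W^{\mathrm{aff}}}(a))=\{1\}\},\quad R^{\sigma\vee}(\rho^\vee)=\{r\in R^\vee:\widehat\gamma^\sigma_{\rho^\vee}(r)=-1\},\quad H^{\sigma\vee}(\rho^\vee)=\{a\in F^\vee: ra=a\text{ for some }r\in R^{\sigma\vee}(\rho^\vee)\}$$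 one has $F^{\sigma\vee}(\rho^\vee)=F^\vee\setminus H^{\sigma\vee}(\rho^\vee)$. -/

import Mathlib

open scoped RealInnerProductSpace

noncomputable section

namespace AffineWeyl

/-- `ℝⁿ` with its standard scalar product. -/
abbrev V (n : ℕ) : Type := EuclideanSpace ℝ (Fin n)

variable {n : ℕ} {ι : Type*} {P : RootPairing ι ℝ (V n) (V n)}

/-- A root pairing of `ℝⁿ` with itself is Euclidean if the pairing is the scalar product and the
coroots are `α^∨ = 2 α / ⟨α, α⟩`; thus `P.root` enumerates a root system `Π ⊆ ℝⁿ` and `P.flip` is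
the dual root system `Π^∨`. -/
class IsEuclidean (P : RootPairing ι ℝ (V n) (V n)) : Prop where
  toLinearMap_apply : ∀ x y : V n, P.toLinearMap x y = ⟪x, y⟫
  coroot_eq : ∀ i, P.coroot i = (2 / ⟪P.root i, P.root i⟫) • P.root i

lemma IsEuclidean.root_eq [IsEuclidean P] (i : ι) :
    P.root i = (2 / ⟪P.coroot i, P.coroot i⟫) • P.coroot i := by
  have h0 : ⟪P.root i, P.root i⟫ ≠ 0 := inner_self_ne_zero.mpr (P.ne_zero i)
  rw [IsEuclidean.coroot_eq i, inner_smul_left, inner_smul_right, smul_smul]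
  simp only [conj_trivial]
  have h1 : 2 / (2 / ⟪P.root i, P.root i⟫ * (2 / ⟪P.root i, P.root i⟫ * ⟪P.root i, P.root i⟫)) *
      (2 / ⟪P.root i, P.root i⟫) = 1 := by
    field_simp
  rw [h1, one_smul]

/-- The dual root system of a Euclidean root system is Euclidean. -/
instance [IsEuclidean P] : IsEuclidean P.flip where
  toLinearMap_apply x y := by
    change P.toLinearMap y x = _
    rw [IsEuclidean.toLinearMap_apply, real_inner_comm]
  coroot_eq i := IsEuclidean.root_eq (P := P) i

lemma coreflection_eq_reflection [IsEuclidean P] (i : ι) : P.coreflection i = P.reflection i := by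
  ext1 x
  have h1 : P.coreflection i x = x - P.toLinearMap (P.root i) x • P.coroot i := rfl
  have h2 : P.reflection i x = x - P.toLinearMap x (P.coroot i) • P.root i := rfl
  rw [h1, h2, IsEuclidean.toLinearMap_apply, IsEuclidean.toLinearMap_apply,
    IsEuclidean.coroot_eq i, inner_smul_right, smul_smul, real_inner_comm x, mul_comm]

/-- The partial order on `ℝⁿ` given by the simple roots: `ν ≤ lam` if and only if `lam - ν` is a
combination of simple roots with nonnegative coefficients. -/
def rootLE (b : P.Base) (ν lam : V n) : Prop :=
  ∃ k : b.support → ℝ, (∀ i, 0 ≤ k i) ∧ lam - ν = ∑ i, k i • P.root i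

/-- The index of the highest root, i.e. of the greatest element of `Π` with respect to `rootLE`. -/
def highestIndex [Nonempty ι] (b : P.Base) : ι :=
  Classical.epsilon fun i => ∀ j, rootLE b (P.root j) (P.root i)

/-- The highest root `ξ`. -/
def highestRoot [Nonempty ι] (b : P.Base) : V n := P.root (highestIndex b)

/-- The mark `m_i`, i.e. the coefficient of the highest root at the simple root `α_i`. -/
def mark [Nonempty ι] [P.IsRootSystem] (b : P.Base) (i : b.support) : ℝ :=
  b.toWeightBasis.repr (highestRoot b) i

/-- The vectors `ω_i^∨`, i.e. the basis dual to the simple roots for the scalar product. -/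
def fundCoweight [P.IsRootSystem] (b : P.Base) (i : b.support) : V n :=
  (InnerProductSpace.toDual ℝ (V n)).symm (LinearMap.toContinuousLinearMap (b.toWeightBasis.coord i))

lemma inner_root_fundCoweight [P.IsRootSystem] [DecidableEq ι] (b : P.Base) (i j : b.support) :
    ⟪P.root i, fundCoweight b j⟫ = if i = j then 1 else 0 := by
  rw [real_inner_comm, fundCoweight, InnerProductSpace.toDual_symm_apply]
  simp [Finsupp.single_apply]

/-- The fundamental domain `F = {∑ y_i ω_i^∨ | y_0, …, y_n ≥ 0, y_0 + ∑ y_i m_i = 1}`. -/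
def fundDomain [Nonempty ι] [P.IsRootSystem] (b : P.Base) : Set (V n) :=
  {a | ∃ (y₀ : ℝ) (y : b.support → ℝ), 0 ≤ y₀ ∧ (∀ i, 0 ≤ y i) ∧
    y₀ + ∑ i, y i * mark b i = 1 ∧ a = ∑ i, y i • fundCoweight b i}

/-- The Weyl group `W`, generated by the reflections in the simple roots. -/
def weylGroup (b : P.Base) : Subgroup (V n ≃ₗ[ℝ] V n) :=
  Subgroup.closure (Set.range fun i : b.support => P.reflection i)

/-- The Weyl group of the dual root system is `W`. -/
lemma weylGroup_flip [IsEuclidean P] (b : P.Base) : weylGroup b.flip = weylGroup b :=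
  congrArg Subgroup.closure <| congrArg Set.range <| funext fun i : b.support =>
    coreflection_eq_reflection (P := P) i

lemma reflection_mem_weylGroup [Finite ι] [P.IsCrystallographic] [P.IsReduced]
    (b : P.Base) (i : ι) : P.reflection i ∈ weylGroup b := by
  refine b.induction_reflect (p := fun i => P.reflection i ∈ weylGroup b) i ?_ ?_ ?_
  · intro i hi
    rw [P.reflection_reflectionPerm]
    exact mul_mem (mul_mem hi hi) hi
  · intro i hi
    exact Subgroup.subset_closure ⟨⟨i, hi⟩, rfl⟩
  · intro i j hi hj
    have hj' : P.reflection j ∈ weylGroup b := Subgroup.subset_closure ⟨⟨j, hj⟩, rfl⟩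
    rw [P.reflection_reflectionPerm]
    exact mul_mem (mul_mem hj' hi) hj'

/-- The affine reflection `r_0 a = r_ξ a + 2 ξ / ⟨ξ, ξ⟩`. -/
def affineReflection [Nonempty ι] (b : P.Base) : V n ≃ᵃ[ℝ] V n :=
  (P.reflection (highestIndex b)).toAffineEquiv.trans
    (AffineEquiv.constVAdd ℝ (V n) ((2 / ⟪highestRoot b, highestRoot b⟫) • highestRoot b))

/-- The set of generators `R = {r_0, r_1, …, r_n}`. -/
def generators [Nonempty ι] (b : P.Base) : Set (V n ≃ᵃ[ℝ] V n) :=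
  insert (affineReflection b) (Set.range fun i : b.support => (P.reflection i).toAffineEquiv)

/-- The affine Weyl group, generated by `R`. -/
def affineWeylGroup [Nonempty ι] (b : P.Base) : Subgroup (V n ≃ᵃ[ℝ] V n) :=
  Subgroup.closure (generators b)

lemma linear_mem_weylGroup [Finite ι] [Nonempty ι] [P.IsCrystallographic] [P.IsReduced]
    (b : P.Base) (w : affineWeylGroup b) :
    (AffineEquiv.linearHom.comp (affineWeylGroup b).subtype) w ∈ weylGroup b := by
  have h : affineWeylGroup b ≤ (weylGroup b).comap AffineEquiv.linearHom := by
    refine (Subgroup.closure_le _).mpr ?_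
    rintro _ (rfl | ⟨i, rfl⟩)
    · exact reflection_mem_weylGroup b (highestIndex b)
    · exact reflection_mem_weylGroup b i
  exact h w.2

/-- The retraction homomorphism `ψ`, which maps `T(q) w` with `w ∈ W` to `w`. -/
def retraction [Finite ι] [Nonempty ι] [P.IsCrystallographic] [P.IsReduced] (b : P.Base) :
    affineWeylGroup b →* weylGroup b :=
  (AffineEquiv.linearHom.comp (affineWeylGroup b).subtype).codRestrict _ (linear_mem_weylGroup b)

/-- The map `τ`, which maps `T(q) w` with `w ∈ W` to `q`, the image of the origin. -/
def translationPart [Nonempty ι] (b : P.Base) (w : affineWeylGroup b) : V n :=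
  (w : V n ≃ᵃ[ℝ] V n) 0

/-- The weight lattice `P`, the `ℤ`-dual of the lattice `Q^∨` spanned by the coroots. -/
def weightLattice (P : RootPairing ι ℝ (V n) (V n)) : Set (V n) :=
  {ω | ∀ q ∈ P.corootSpan ℤ, ∃ z : ℤ, ⟪ω, q⟫ = z}

/-- `ρ` is an admissible dual shift if `W (ρ + P) = ρ + P` for the weight lattice `P`. -/
def IsAdmissibleDualShift (b : P.Base) (ρ : V n) : Prop :=
  {y | ∃ w ∈ weylGroup b, ∃ p ∈ weightLattice P, y = w (ρ + p)} =
    {y | ∃ p ∈ weightLattice P, y = ρ + p}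

/-- The dual shift homomorphism `θ_ρ(w) = exp(2 π i ⟨τ(w), ρ⟩)`. -/
def shiftHom [Nonempty ι] (b : P.Base) (ρ : V n) (w : affineWeylGroup b) : ℂ :=
  Complex.exp (2 * Real.pi * Complex.I * (⟪translationPart b w, ρ⟫ : ℝ))

section Domains

variable [Finite ι] [Nonempty ι] [P.IsCrystallographic] [P.IsReduced]

/-- `γ^σ_ρ(w) = θ_ρ(w) σ(ψ(w))`, for a sign homomorphism `σ : W → {±1}`. -/
def gamma (b : P.Base) (σ : weylGroup b →* ℤˣ) (ρ : V n) (w : affineWeylGroup b) : ℂ :=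
  shiftHom b ρ w * ((σ (retraction b w) : ℤ) : ℂ)

/-- The stabilizer of the point `a` in the affine Weyl group. -/
def stab (b : P.Base) (a : V n) : Set (affineWeylGroup b) :=
  {w | (w : V n ≃ᵃ[ℝ] V n) a = a}

/-- `R^σ(ρ) = {r ∈ R | γ^σ_ρ(r) = -1}`. -/
def negGenerators (b : P.Base) (σ : weylGroup b →* ℤˣ) (ρ : V n) : Set (affineWeylGroup b) :=
  {r | (r : V n ≃ᵃ[ℝ] V n) ∈ generators b ∧ gamma b σ ρ r = -1}

/-- `F^σ(ρ) = {a ∈ F | γ^σ_ρ(Stab(a)) = {1}}`. -/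
def signDomain [P.IsRootSystem] (b : P.Base) (σ : weylGroup b →* ℤˣ) (ρ : V n) : Set (V n) :=
  {a ∈ fundDomain b | gamma b σ ρ '' stab b a = {1}}

/-- `H^σ(ρ) = {a ∈ F | ∃ r ∈ R^σ(ρ), r a = a}`. -/
def negBoundary [P.IsRootSystem] (b : P.Base) (σ : weylGroup b →* ℤˣ) (ρ : V n) : Set (V n) :=
  {a ∈ fundDomain b | ∃ r ∈ negGenerators b σ ρ, (r : V n ≃ᵃ[ℝ] V n) a = a}

end Domains

/-! The dual notions. They are the above ones for the dual root system `Π^∨` with the simple roots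
`Δ^∨`: its highest root is the dual highest root `η`, its affine reflection is
`r_0^∨ a = r_η a + 2 η / ⟨η, η⟩`, its marks are the dual marks, its coroot lattice is `Q`, its
weight lattice is `P^∨`, and its fundamental coweights are the `ω_i`. The Weyl group and its sign
homomorphisms are those of `Π`. -/

/-- `ρ^∨` is an admissible shift if `W (ρ^∨ + P^∨) = ρ^∨ + P^∨`. -/
def IsAdmissibleShift (b : P.Base) (ρ : V n) : Prop := IsAdmissibleDualShift b.flip ρ

/-- A sign homomorphism of `W`, as a homomorphism on the (equal) Weyl group of `Π^∨`. -/
def signFlip [IsEuclidean P] {b : P.Base} (σ : weylGroup b →* ℤˣ) : weylGroup b.flip →* ℤˣ :=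
  σ.comp (MulEquiv.subgroupCongr (weylGroup_flip b)).toMonoidHom

/-- The dual fundamental domain `F^∨ = {∑ z_i ω_i | z_0, …, z_n ≥ 0, z_0 + ∑ z_i m_i^∨ = 1}`. -/
def dualFundDomain [Nonempty ι] [P.IsRootSystem] (b : P.Base) : Set (V n) := fundDomain b.flip

section DualDomains

variable [Finite ι] [Nonempty ι] [P.IsCrystallographic] [P.IsReduced] [P.IsRootSystem]
  [IsEuclidean P]

/-- `F^{σ∨}(ρ^∨)`, the points of `F^∨` on whose stabilizer in the dual affine Weyl group the dual
`γ`-homomorphism is trivial. -/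
def dualSignDomain (b : P.Base) (σ : weylGroup b →* ℤˣ) (ρ : V n) : Set (V n) :=
  signDomain b.flip (signFlip σ) ρ

/-- `H^{σ∨}(ρ^∨)`, the points of `F^∨` fixed by a generator `r ∈ R^∨` of the dual affine Weyl group
on which the dual `γ`-homomorphism is `-1`. -/
def dualNegBoundary (b : P.Base) (σ : weylGroup b →* ℤˣ) (ρ : V n) : Set (V n) :=
  negBoundary b.flip (signFlip σ) ρ

end DualDomains

end AffineWeyl

end

/-! By admissibility `γ = γ^σ_ρ` is a homomorphism: `τ(ww') = ψ(w)τ(w') + τ(w)`, and `ψ(w)⁻¹` moves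
`ρ` by a weight, which pairs integrally with the coroot lattice. Each generator in `R` is an
involution, so `γ` is `±1` on it. If the stabilizer of `a ∈ F` is generated by the elements of `R`
that fix `a`, then `γ` is trivial on it exactly when none of these has value `-1`, which is the
claim.

The generation statement (`stab_subset_closure`) carries the weight. It rests on the exchange
argument for Coxeter groups, run on affine roots: each generator keeps every positive affine root
positive except its own simple one (`generator_pos`), and positive affine roots are nonnegative on
`F` (`nonneg_of_mem_fundDomain`). For `r_0` this needs the highest root to dominate all roots, which
is where irreducibility enters.

The second half is the first half for the dual root system. -/

/-- A group generated by involutions which permute, up to one sign change each, a set of positive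
functions: an element fixing a point `a` at which all positive functions are nonnegative is a
product of generators fixing `a`. -/
theorem mem_closure_of_smul_eq {G X κ : Type*} [Group G] [MulAction G X]
    (s : κ → G) (f : κ → X → ℝ) (pos : Set (X → ℝ))
    (hgen : Subgroup.closure (Set.range s) = ⊤)
    (hs : ∀ i, s i * s i = 1)
    (hf : ∀ i, f i ∈ pos)
    (hfs : ∀ i x, f i (s i • x) = -f i x)
    (hpos : ∀ i, ∀ g ∈ pos, g = f i ∨ (fun x => g (s i • x)) ∈ pos)
    (hconj : ∀ i j (w : G), (∀ x, f i (w⁻¹ • x) = f j x) → w * s i = s j * w)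
    (a : X) (ha : ∀ g ∈ pos, 0 ≤ g a) (hfix : ∀ i, f i a = 0 → s i • a = a)
    (w : G) (hw : w • a = a) :
    w ∈ Subgroup.closure {g | g • a = a ∧ ∃ i, s i = g} := by
  have hinv : ∀ i, (s i)⁻¹ = s i := fun i => inv_eq_of_mul_eq_one_left (hs i)
  -- each group element is the product of a word in the generators
  have hword : ∀ w : G, ∃ l : List κ, (l.map s).prod = w := by
    intro w
    have h : w ∈ Subgroup.closure (Set.range s) := hgen ▸ Subgroup.mem_top w
    induction h using Subgroup.closure_induction with
    | mem x hx => obtain ⟨i, rfl⟩ := hx; exact ⟨[i], by simp⟩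
    | one => exact ⟨[], rfl⟩
    | mul x y _ _ hx hy =>
      obtain ⟨l, rfl⟩ := hx
      obtain ⟨m, rfl⟩ := hy
      exact ⟨l ++ m, by simp⟩
    | inv x _ hx =>
      obtain ⟨l, rfl⟩ := hx
      refine ⟨l.reverse, ?_⟩
      rw [List.prod_inv_reverse, List.map_reverse, List.map_map]
      congr 2
      exact List.map_congr_left fun i _ => (hinv i).symm
  -- the exchange property
  have hexch : ∀ (l : List κ) (i : κ),
      (fun x => f i ((l.map s).prod⁻¹ • x)) ∈ pos ∨
        ∃ m : List κ, m.length + 1 = l.length ∧ (m.map s).prod = (l.map s).prod * s i := by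
    intro l
    induction l with
    | nil => intro i; left; simpa using hf i
    | cons j l ih =>
      intro i
      rcases ih i with h | ⟨m, hm, hm'⟩
      · rcases hpos j _ h with h' | h'
        · right
          refine ⟨l, rfl, ?_⟩
          -- With `w` the product of `l`, `w s_i = s_j w`, so `s_j w s_i = w`: the letter `j` is
          -- deleted.
          have h2 := hconj i j _ (fun x => congrFun h' x)
          rw [List.map_cons, List.prod_cons, mul_assoc, h2, ← mul_assoc, hs, one_mul]
        · left
          simpa only [List.map_cons, List.prod_cons, mul_inv_rev, hinv, mul_smul] using h'
      · right
        refine ⟨j :: m, by simpa using hm, ?_⟩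
        rw [List.map_cons, List.prod_cons, hm', List.map_cons, List.prod_cons, mul_assoc]
  suffices H : ∀ (k : ℕ) (l : List κ), l.length = k → (l.map s).prod • a = a →
      (l.map s).prod ∈ Subgroup.closure {g | g • a = a ∧ ∃ i, s i = g} by
    obtain ⟨l, rfl⟩ := hword w
    exact H _ l rfl hw
  intro k
  induction k using Nat.strong_induction_on with
  | _ k ih =>
    intro l hl hla
    rcases List.eq_nil_or_concat l with rfl | ⟨l', i, rfl⟩
    · simp
    rw [List.concat_eq_append] at *
    simp only [List.length_append, List.length_singleton] at hl
    simp only [List.map_append, List.map_singleton, List.prod_append, List.prod_singleton] at *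
    rcases hexch l' i with h | ⟨m, hm, hm'⟩
    · -- the last letter fixes `a`
      have h1 := ha _ h
      have h2 : (l'.map s).prod⁻¹ • a = s i • a := by
        rw [inv_smul_eq_iff, ← mul_smul, hla]
      simp only [h2, hfs] at h1
      have h3 := hfix i (le_antisymm (by linarith) (ha _ (hf i)))
      refine mul_mem (ih _ (by omega) l' rfl ?_) (Subgroup.subset_closure ⟨h3, i, rfl⟩)
      rwa [mul_smul, h3] at hla
    -- Here `m` is two letters shorter than the original word, hence strong induction.
    · rw [← hm'] at hla ⊢
      exact ih _ (by omega) m rfl hla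

namespace AffineWeyl

variable {n : ℕ} {ι : Type*} {P : RootPairing ι ℝ (V n) (V n)}

/-! ### Euclidean root systems: sums and differences of roots -/

lemma inner_root_coroot [IsEuclidean P] (i j : ι) : ⟪P.root i, P.coroot j⟫ = P.pairing i j := by
  rw [← IsEuclidean.toLinearMap_apply (P := P), P.root_coroot_eq_pairing]

lemma reflection_eq_sub [IsEuclidean P] (i : ι) (x : V n) :
    P.reflection i x = x - ⟪P.root i, x⟫ • P.coroot i := by
  rw [← coreflection_eq_reflection]
  change x - P.toLinearMap (P.root i) x • P.coroot i = _
  rw [IsEuclidean.toLinearMap_apply]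

lemma inner_root_self_pos (i : ι) : 0 < ⟪P.root i, P.root i⟫ :=
  real_inner_self_pos.mpr (P.ne_zero i)

lemma pairing_pos_iff [IsEuclidean P] (i j : ι) :
    0 < P.pairing i j ↔ 0 < ⟪P.root i, P.root j⟫ := by
  rw [← inner_root_coroot, IsEuclidean.coroot_eq, inner_smul_right]
  exact mul_pos_iff_of_pos_left (div_pos two_pos (inner_root_self_pos j))

lemma pairing_neg_iff [IsEuclidean P] (i j : ι) :
    P.pairing i j < 0 ↔ ⟪P.root i, P.root j⟫ < 0 := by
  rw [← inner_root_coroot, IsEuclidean.coroot_eq, inner_smul_right]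
  have h : 0 < 2 / ⟪P.root j, P.root j⟫ := div_pos two_pos (inner_root_self_pos j)
  exact ⟨fun h' => by by_contra! h0; exact absurd (mul_nonneg h.le h0) (not_le.mpr h'),
    mul_neg_of_pos_of_neg h⟩

lemma exists_root_eq_add [Finite ι] [P.IsCrystallographic] [IsEuclidean P] {i j : ι}
    (h : ⟪P.root i, P.root j⟫ < 0) (h' : P.root i ≠ -P.root j) :
    ∃ k, P.root k = P.root i + P.root j := by
  refine P.root_add_root_mem_of_pairingIn_neg ?_ h'
  rw [← pairing_neg_iff, ← P.algebraMap_pairingIn ℤ] at h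
  simpa using h

lemma exists_root_eq_sub [Finite ι] [P.IsCrystallographic] [IsEuclidean P] {i j : ι}
    (h : 0 < ⟪P.root i, P.root j⟫) (h' : i ≠ j) :
    ∃ k, P.root k = P.root i - P.root j := by
  refine P.root_sub_root_mem_of_pairingIn_pos ?_ h'
  rw [← pairing_pos_iff, ← P.algebraMap_pairingIn ℤ] at h
  simpa using h

lemma exists_pairing_eq_intCast [P.IsCrystallographic] (i j : ι) : ∃ z : ℤ, P.pairing i j = z :=
  ⟨P.pairingIn ℤ i j, by rw [← P.algebraMap_pairingIn ℤ]; simp⟩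

lemma exists_root_eq_neg (i : ι) : ∃ j, P.root j = -P.root i :=
  ⟨P.reflectionPerm i i, by rw [P.root_reflectionPerm, P.reflection_apply_self]⟩

lemma inner_root_root_nonpos [Finite ι] [P.IsCrystallographic] [IsEuclidean P]
    {b : P.Base} {i j : b.support} (hij : i ≠ j) : ⟪P.root i, P.root j⟫ ≤ 0 := by
  by_contra! h
  obtain ⟨k, hk⟩ := exists_root_eq_sub h (Subtype.coe_injective.ne hij)
  exact b.sub_notMem_range_root i.2 j.2 ⟨k, hk⟩

/-! ### Coordinates in the simple roots, positive roots and height -/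

section RootSystem

variable [P.IsRootSystem] (b : P.Base)

/-- A vector is nonnegative if its coefficients with respect to the simple roots are. -/
def IsNonneg (v : V n) : Prop := ∀ i, 0 ≤ b.toWeightBasis.repr v i

variable {b}

lemma IsNonneg.add {v w : V n} (hv : IsNonneg b v) (hw : IsNonneg b w) : IsNonneg b (v + w) := by
  intro i
  simpa using add_nonneg (hv i) (hw i)

lemma IsNonneg.smul {v : V n} (hv : IsNonneg b v) {c : ℝ} (hc : 0 ≤ c) : IsNonneg b (c • v) := by
  intro i
  simpa using mul_nonneg hc (hv i)

lemma IsNonneg.eq_zero {v : V n} (hv : IsNonneg b v) (hv' : IsNonneg b (-v)) : v = 0 := by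
  refine b.toWeightBasis.repr.injective (Finsupp.ext fun i => le_antisymm ?_ ?_)
  · simpa using hv' i
  · simpa using hv i

lemma isNonneg_root (i : b.support) : IsNonneg b (P.root i) := by
  intro j
  classical
  rw [b.toWeightBasis_repr_root, Finsupp.single_apply]
  split_ifs <;> simp

variable (b) in
lemma isNonneg_or_neg (i : ι) : IsNonneg b (P.root i) ∨ IsNonneg b (-P.root i) := by
  have h : ∀ v ∈ AddSubmonoid.closure (P.root '' b.support), IsNonneg b v := by
    intro v hv
    induction hv using AddSubmonoid.closure_induction with
    | mem x hx =>
      obtain ⟨j, hj, rfl⟩ := hx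
      exact isNonneg_root ⟨j, hj⟩
    | zero => intro i; simp
    | add x y _ _ hx hy => exact hx.add hy
  exact (b.root_mem_or_neg_mem i).imp (h _) (h _)

lemma rootLE_iff {v w : V n} : rootLE b v w ↔ IsNonneg b (w - v) := by
  constructor
  · rintro ⟨k, hk, h⟩
    rw [h]
    intro i
    have := b.toWeightBasis.repr_sum_self k
    simp only [b.toWeightBasis_apply] at this
    rw [this]
    exact hk i
  · intro h
    refine ⟨b.toWeightBasis.repr (w - v), h, ?_⟩
    conv_lhs => rw [← b.toWeightBasis.sum_repr (w - v)]
    simp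

variable (b) in
/-- The sum of the coefficients of a vector with respect to the simple roots. -/
noncomputable def heightForm : V n →ₗ[ℝ] ℝ := ∑ i, b.toWeightBasis.coord i

lemma heightForm_root (i : b.support) : heightForm b (P.root i) = 1 := by
  classical
  simp [heightForm, Finsupp.single_apply]

lemma IsNonneg.heightForm_nonneg {v : V n} (hv : IsNonneg b v) : 0 ≤ heightForm b v := by
  simpa [heightForm] using Finset.sum_nonneg fun i _ => hv i

lemma IsNonneg.heightForm_pos {v : V n} (hv : IsNonneg b v) (h : v ≠ 0) : 0 < heightForm b v := by
  refine hv.heightForm_nonneg.lt_of_ne fun h0 => h ?_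
  have h1 : ∑ i, b.toWeightBasis.repr v i = 0 := by simpa [heightForm] using h0.symm
  rw [Finset.sum_eq_zero_iff_of_nonneg fun i _ => hv i] at h1
  exact b.toWeightBasis.repr.injective (Finsupp.ext fun i => by simpa using h1 i)

/-- By reducedness the root has a positive coefficient at some `k ≠ i`. The reflection changes only
the coefficient at `i`, and one positive coefficient makes a root positive. -/
lemma isNonneg_reflection [Finite ι] [P.IsReduced] [IsEuclidean P] {i : b.support} {j : ι}
    (hj : IsNonneg b (P.root j)) (hij : P.root j ≠ P.root i) :
    IsNonneg b (P.reflection i (P.root j)) := by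
  classical
  obtain ⟨k, hki, hk⟩ : ∃ k, k ≠ i ∧ 0 < b.toWeightBasis.repr (P.root j) k := by
    by_contra! h
    have h0 : P.root j = b.toWeightBasis.repr (P.root j) i • P.root i := by
      conv_lhs => rw [← b.toWeightBasis.sum_repr (P.root j)]
      rw [Finset.sum_eq_single i]
      · simp
      · intro k _ hk
        rw [le_antisymm (h k hk) (hj k), zero_smul]
      · simp
    have h1 : ¬ LinearIndependent ℝ ![P.root j, P.root i] := by
      rw [LinearIndependent.pair_iff]
      push Not
      refine ⟨1, -(b.toWeightBasis.repr (P.root j) i), ?_, by simp⟩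
      rw [one_smul, neg_smul, ← h0, add_neg_cancel]
    rcases RootPairing.IsReduced.eq_or_eq_neg j (i : ι) h1 with h2 | h2
    · exact hij h2
    · have := hj i
      rw [h2] at this
      simp at this
      linarith
  rw [← P.root_reflectionPerm]
  refine (isNonneg_or_neg b _).resolve_right fun h => ?_
  have h1 := h k
  rw [P.root_reflectionPerm, P.reflection_apply_root] at h1
  simp [hki.symm] at h1
  linarith

lemma inner_eq_sum_repr (v w : V n) :
    ⟪v, w⟫ = ∑ i, b.toWeightBasis.repr v i * ⟪P.root i, w⟫ := by
  conv_lhs => rw [← b.toWeightBasis.sum_repr v]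
  simp [sum_inner, inner_smul_left]

end RootSystem

/-! ### Existence of the highest root -/

section Highest

variable [Finite ι] [Nonempty ι] [P.IsCrystallographic] [P.IsIrreducible] [IsEuclidean P]
  {b : P.Base}

/-- In an irreducible root system, a nonzero dominant nonnegative vector has full support. -/
lemma repr_pos_of_dominant [P.IsReduced] {v : V n} (hv0 : v ≠ 0) (hv : IsNonneg b v)
    (hd : ∀ i : b.support, 0 ≤ ⟪v, P.root i⟫) (i : b.support) :
    0 < b.toWeightBasis.repr v i := by
  set J : Set b.support := {i | 0 < b.toWeightBasis.repr v i} with hJ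
  have hJc : ∀ i, i ∉ J → b.toWeightBasis.repr v i = 0 := fun i hi =>
    le_antisymm (not_lt.mp hi) (hv i)
  -- For `i ∉ J` the expansion of `⟪v, α_i⟫` has only nonpositive terms; dominance forces each to
  -- vanish.
  have horth : ∀ i ∉ J, ∀ j ∈ J, ⟪P.root j, P.root i⟫ = 0 := by
    intro i hi j hj
    have hle : ∀ k, b.toWeightBasis.repr v k * ⟪P.root k, P.root i⟫ ≤ 0 := by
      intro k
      by_cases hk : k = i
      · rw [hk, hJc i hi, zero_mul]
      · exact mul_nonpos_of_nonneg_of_nonpos (hv k) (inner_root_root_nonpos hk)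
    have h0 := hd i
    rw [inner_eq_sum_repr (b := b)] at h0
    have h1 := (Finset.sum_eq_zero_iff_of_nonpos fun k _ => hle k).mp
      (le_antisymm (Finset.sum_nonpos fun k _ => hle k) h0) j (Finset.mem_univ _)
    exact (mul_eq_zero.mp h1).resolve_left (ne_of_gt hj)
  have hJne : J.Nonempty := by
    by_contra! h
    refine hv0 (b.toWeightBasis.repr.injective (Finsupp.ext fun i => ?_))
    simpa using hJc i (by simp [h])
  set q : Submodule ℝ (V n) := Submodule.span ℝ ((fun j : b.support => P.root j) '' J) with hq
  -- By this orthogonality `q` is stable under all simple reflections, so irreducibility applies; a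
  -- simple root outside `J` would then contradict linear independence.
  have hqtop : q = ⊤ := by
    refine RootPairing.IsIrreducible.eq_top_of_invtSubmodule_reflection (P := P) q ?_ ?_
    · refine (b.forall_mem_support_invtSubmodule_iff q).mp fun i hi => ?_
      rw [Module.End.mem_invtSubmodule]
      by_cases hiJ : (⟨i, hi⟩ : b.support) ∈ J
      · intro x hx
        have h1 : P.root i ∈ q := Submodule.subset_span ⟨⟨i, hi⟩, hiJ, rfl⟩
        have h2 : P.reflection i x = x - P.toLinearMap x (P.coroot i) • P.root i := rfl
        change P.reflection i x ∈ q
        rw [h2]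
        exact q.sub_mem hx (q.smul_mem _ h1)
      · refine Submodule.span_le.mpr ?_
        rintro _ ⟨j, hj, rfl⟩
        have h1 := horth _ hiJ j hj
        change P.reflection i (P.root j) ∈ q
        rw [reflection_eq_sub, real_inner_comm, h1, zero_smul, sub_zero]
        exact Submodule.subset_span ⟨j, hj, rfl⟩
    · obtain ⟨j, hj⟩ := hJne
      intro h
      have h1 : P.root j ∈ q := Submodule.subset_span ⟨j, hj, rfl⟩
      rw [h, Submodule.mem_bot] at h1
      exact P.ne_zero _ h1
  by_contra hi
  have h1 : b.toWeightBasis i ∈ Submodule.span ℝ (b.toWeightBasis '' J) := by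
    have : (b.toWeightBasis : b.support → V n) = fun j : b.support => P.root j := by
      ext1 j; simp
    rw [this, ← hq, hqtop]
    trivial
  have h2 : i ∈ J := by simpa using b.toWeightBasis.mem_span_image.mp h1
  exact hi h2

variable (b)

/-- Every root lies below a maximal one, which is nonnegative and dominant. -/
lemma exists_maximal_ge (i : ι) : ∃ j, IsNonneg b (P.root j - P.root i) ∧ IsNonneg b (P.root j) ∧
    (∀ k : b.support, 0 ≤ ⟪P.root j, P.root k⟫) ∧
    ∀ k, IsNonneg b (P.root k - P.root j) → P.root k = P.root j := by
  have hne : {j | IsNonneg b (P.root j - P.root i)}.Nonempty := ⟨i, by simp [IsNonneg]⟩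
  -- Maximal height among the roots above `i` excludes any larger root. If `α_j` were negative,
  -- `-α_j` would be higher; if `⟪α_j, α_k⟫ < 0`, so would the root `α_j + α_k`.
  obtain ⟨j, hj, hmax⟩ := Set.exists_max_image _ (fun j => heightForm b (P.root j))
    (Set.toFinite {j | IsNonneg b (P.root j - P.root i)}) hne
  have hpos : IsNonneg b (P.root j) := by
    refine (isNonneg_or_neg b j).resolve_right fun h => ?_
    obtain ⟨k, hk⟩ := exists_root_eq_neg (P := P) j
    have h1 := hmax k (by
      have h2 : P.root k - P.root i = (2 : ℝ) • (-P.root j) + (P.root j - P.root i) := by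
        rw [hk]; module
      change IsNonneg b _
      rw [h2]
      exact (h.smul zero_le_two).add hj)
    have h3 := h.heightForm_pos (neg_ne_zero.mpr (P.ne_zero j))
    rw [hk] at h1
    rw [map_neg] at h1 h3
    linarith
  refine ⟨j, hj, hpos, fun k => ?_, fun k hk => ?_⟩
  swap
  · have h1 := hmax k (by
      change IsNonneg b _
      rw [← sub_add_sub_cancel _ (P.root j)]
      exact hk.add hj)
    by_contra h
    have h2 := hk.heightForm_pos (sub_ne_zero.mpr h)
    rw [map_sub] at h2
    linarith
  by_contra! h
  have hne' : P.root j ≠ -P.root k := by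
    intro h0
    have h1 := hpos.heightForm_nonneg
    rw [h0, map_neg, heightForm_root] at h1
    linarith
  obtain ⟨l, hl⟩ := exists_root_eq_add h hne'
  have h1 := hmax l (by
    change IsNonneg b _
    rw [hl, add_sub_right_comm]
    exact IsNonneg.add hj (isNonneg_root k))
  rw [hl, map_add, heightForm_root] at h1
  linarith

variable [P.IsReduced]

/-- Full support of one dominant root makes its product with the other positive. If they differed,
their difference would be a root, and either sign of it contradicts maximality. -/
lemma eq_of_dominant {i j : ι}
    (hdi : ∀ k : b.support, 0 ≤ ⟪P.root i, P.root k⟫)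
    (hmi : ∀ k, IsNonneg b (P.root k - P.root i) → P.root k = P.root i)
    (hj : IsNonneg b (P.root j)) (hdj : ∀ k : b.support, 0 ≤ ⟪P.root j, P.root k⟫)
    (hmj : ∀ k, IsNonneg b (P.root k - P.root j) → P.root k = P.root j) :
    P.root j = P.root i := by
  have hpos : 0 < ⟪P.root j, P.root i⟫ := by
    rw [inner_eq_sum_repr (b := b)]
    have h0 : ∀ k : b.support, 0 ≤ ⟪P.root k, P.root i⟫ := fun k => by
      rw [real_inner_comm]; exact hdi k
    refine Finset.sum_pos' (fun k _ => mul_nonneg (hj k) (h0 k)) ?_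
    by_contra! h
    have h1 : ∀ k : b.support, ⟪P.root k, P.root i⟫ = 0 := fun k =>
      le_antisymm (not_lt.mp fun hk => not_lt.mpr (h k (Finset.mem_univ k))
        (mul_pos (repr_pos_of_dominant (P.ne_zero j) hj hdj k) hk)) (h0 k)
    have h2 := inner_root_self_pos (P := P) i
    rw [inner_eq_sum_repr (b := b)] at h2
    simp [h1] at h2
  by_contra hne
  obtain ⟨k, hk⟩ := exists_root_eq_sub hpos (fun h => hne (by rw [h]))
  rcases isNonneg_or_neg b k with h | h
  · exact hne (hmi j (hk ▸ h))
  · rw [hk, neg_sub] at h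
    exact hne (hmj i h).symm

/-- This makes the choice by `Classical.epsilon` in `highestIndex` meaningful. -/
lemma exists_highest : ∃ i, ∀ j, rootLE b (P.root j) (P.root i) := by
  obtain ⟨i, -, -, hdi, hmi⟩ := exists_maximal_ge b (Classical.arbitrary ι)
  refine ⟨i, fun j => rootLE_iff.mpr ?_⟩
  obtain ⟨k, hjk, hk, hdk, hmk⟩ := exists_maximal_ge b j
  rwa [← eq_of_dominant b hdi hmi hk hdk hmk]

lemma isNonneg_highestRoot_sub (j : ι) : IsNonneg b (highestRoot b - P.root j) :=
  rootLE_iff.mp (Classical.epsilon_spec (exists_highest b) j)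

end Highest

/-! ### Generators as reflections in the simple affine roots -/

lemma coroot_highestIndex [Nonempty ι] [IsEuclidean P] (b : P.Base) :
    P.coroot (highestIndex b) = (2 / ⟪highestRoot b, highestRoot b⟫) • highestRoot b :=
  IsEuclidean.coroot_eq _

lemma affineReflection_apply [Nonempty ι] [IsEuclidean P] (b : P.Base) (x : V n) :
    affineReflection b x =
      x + (1 - ⟪highestRoot b, x⟫) • P.coroot (highestIndex b) := by
  have h : affineReflection b x =
      (2 / ⟪highestRoot b, highestRoot b⟫) • highestRoot b + P.reflection (highestIndex b) x := rfl
  rw [h, reflection_eq_sub, ← coroot_highestIndex]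
  change _ + (x - ⟪highestRoot b, x⟫ • _) = _
  module

section

variable [Nonempty ι] (b : P.Base)

/-- The generators `r_0, r_1, …, r_n` of the affine Weyl group as an indexed family. -/
noncomputable def generator : Option b.support → V n ≃ᵃ[ℝ] V n
  | none => affineReflection b
  | some i => (P.reflection i).toAffineEquiv

/-- The simple affine roots `1 - ξ, α_1, …, α_n`. -/
noncomputable def simpleAffineRoot : Option b.support → V n → ℝ
  | none => fun x => 1 - ⟪highestRoot b, x⟫
  | some i => fun x => ⟪P.root i, x⟫

/-- The linear parts `-ξ, α_1, …, α_n` of the simple affine roots. -/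
noncomputable def simpleGradient : Option b.support → V n
  | none => -highestRoot b
  | some i => P.root i

/-- The coroots `-ξ^∨, α_1^∨, …, α_n^∨` of the linear parts of the simple affine roots. -/
noncomputable def simpleCogradient : Option b.support → V n
  | none => -P.coroot (highestIndex b)
  | some i => P.coroot i

/-- The positive affine roots `α + k`, i.e. those with `k > 0`, or with `k = 0` and `α` positive. -/
def positiveAffineRoots [P.IsRootSystem] : Set (V n → ℝ) :=
  {g | ∃ (i : ι) (k : ℤ), (0 < k ∨ k = 0 ∧ IsNonneg b (P.root i)) ∧
    g = fun x => ⟪P.root i, x⟫ + k}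

lemma range_generator : Set.range (generator b) = generators b := by
  ext g
  simp [generators, Option.exists, generator, eq_comm]

lemma simpleAffineRoot_eq (i : Option b.support) (x : V n) :
    simpleAffineRoot b i x = ⟪simpleGradient b i, x⟫ + simpleAffineRoot b i 0 := by
  cases i <;> simp [simpleAffineRoot, simpleGradient]
  ring

lemma simpleGradient_ne_zero (i : Option b.support) : simpleGradient b i ≠ 0 := by
  cases i with
  | none => exact neg_ne_zero.mpr (P.ne_zero _)
  | some i => exact P.ne_zero _

lemma simpleAffineRoot_mem [P.IsRootSystem] (i : Option b.support) :
    simpleAffineRoot b i ∈ positiveAffineRoots b := by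
  cases i with
  | none =>
    obtain ⟨j, hj⟩ := exists_root_eq_neg (P := P) (highestIndex b)
    refine ⟨j, 1, Or.inl one_pos, funext fun x => ?_⟩
    rw [hj, inner_neg_left]
    simp only [simpleAffineRoot, highestRoot]
    push_cast
    ring
  | some i =>
    exact ⟨i, 0, Or.inr ⟨rfl, isNonneg_root i⟩, funext fun x => by simp [simpleAffineRoot]⟩

variable [IsEuclidean P]

lemma generator_apply (i : Option b.support) (x : V n) :
    generator b i x = x - simpleAffineRoot b i x • simpleCogradient b i := by
  cases i with
  | none =>
    simp only [generator, affineReflection_apply, simpleAffineRoot, simpleCogradient]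
    module
  | some i => exact reflection_eq_sub (i : ι) x

lemma simpleCogradient_eq (i : Option b.support) : simpleCogradient b i =
    (2 / ⟪simpleGradient b i, simpleGradient b i⟫) • simpleGradient b i := by
  cases i with
  | none =>
    simp only [simpleCogradient, simpleGradient, inner_neg_neg, coroot_highestIndex, smul_neg]
  | some i => exact IsEuclidean.coroot_eq _

lemma simpleAffineRoot_generator (i : Option b.support) (x : V n) :
    simpleAffineRoot b i (generator b i x) = -simpleAffineRoot b i x := by
  have h0 : ⟪simpleGradient b i, simpleGradient b i⟫ ≠ 0 :=
    inner_self_ne_zero.mpr (simpleGradient_ne_zero b i)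
  rw [generator_apply, simpleAffineRoot_eq, inner_sub_right, inner_smul_right, simpleCogradient_eq,
    inner_smul_right, div_mul_cancel₀ _ h0]
  have := simpleAffineRoot_eq b i x
  linarith

lemma generator_mul_self (i : Option b.support) : generator b i * generator b i = 1 := by
  ext1 x
  change generator b i (generator b i x) = x
  rw [generator_apply b i (generator b i x), simpleAffineRoot_generator, generator_apply]
  module

/-- An affine reflection is determined by its affine root: an isometry carrying one affine root to
another carries gradient to gradient, hence cogradient to cogradient. -/
lemma generator_conj {i j : Option b.support} {w : V n ≃ᵃ[ℝ] V n}
    (hw : ∀ x y, ⟪w.linear x, w.linear y⟫ = ⟪x, y⟫)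
    (h : ∀ x, simpleAffineRoot b i (w⁻¹ x) = simpleAffineRoot b j x) :
    w * generator b i = generator b j * w := by
  have h' : ∀ x, simpleAffineRoot b i x = simpleAffineRoot b j (w x) := fun x => by
    rw [← h]
    congr 1
    exact (w.symm_apply_apply x).symm
  have hmap : ∀ x y : V n, w (x + y) = w.linear y + w x := fun x y => by
    have := w.map_vadd x y
    rwa [vadd_eq_add, vadd_eq_add, add_comm y] at this
  have hgrad : w.linear (simpleGradient b i) = simpleGradient b j := by
    refine ext_inner_right ℝ fun x => ?_
    obtain ⟨y, rfl⟩ := w.linear.surjective x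
    rw [hw]
    have hy : w y = w.linear y + w 0 := by simpa using hmap 0 y
    have h1 := h' y
    have h2 := h' 0
    rw [hy, simpleAffineRoot_eq, simpleAffineRoot_eq b j, inner_add_right] at h1
    rw [simpleAffineRoot_eq b j] at h2
    linarith
  have hcograd : w.linear (simpleCogradient b i) = simpleCogradient b j := by
    rw [simpleCogradient_eq, simpleCogradient_eq, map_smul, hgrad, ← hgrad, hw]
  ext1 x
  change w (generator b i x) = generator b j (w x)
  rw [generator_apply, generator_apply, ← h', sub_eq_add_neg, hmap, map_neg, map_smul, hcograd]
  module

lemma inner_root_affineReflection (i : ι) (x : V n) : ⟪P.root i, affineReflection b x⟫ =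
    ⟪P.reflection (highestIndex b) (P.root i), x⟫ + P.pairing i (highestIndex b) := by
  rw [affineReflection_apply, P.reflection_apply_root, inner_add_right, inner_smul_right,
    inner_root_coroot, inner_sub_left, inner_smul_left]
  simp only [conj_trivial, highestRoot]
  ring

end

/-! ### Action of the generators on positive affine roots -/

section Positive

variable [Finite ι] [Nonempty ι] [P.IsCrystallographic] [P.IsReduced] [P.IsIrreducible]
  [IsEuclidean P] (b : P.Base)

lemma isNonneg_highestRoot_add (i : ι) : IsNonneg b (highestRoot b + P.root i) := by
  obtain ⟨j, hj⟩ := exists_root_eq_neg (P := P) i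
  have := isNonneg_highestRoot_sub b j
  rwa [hj, sub_neg_eq_add] at this

/-- With `z = ⟨α, ξ^∨⟩`, `r_0` sends `α + k` to `(α - zξ) + (k + z)`. All roots lie between `-ξ` and
`ξ`, so `z ≥ -1` unless `α = -ξ`; hence only small `k` needs care. -/
lemma affineReflection_pos {g : V n → ℝ} (hg : g ∈ positiveAffineRoots b) :
    g = simpleAffineRoot b none ∨ (fun x => g (affineReflection b x)) ∈ positiveAffineRoots b := by
  obtain ⟨i, k, hk, rfl⟩ := hg
  obtain ⟨z, hz⟩ := exists_pairing_eq_intCast (P := P) i (highestIndex b)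
  have hroot := P.root_reflectionPerm (highestIndex b) i
  have hroot' : P.root (P.reflectionPerm (highestIndex b) i) =
      P.root i - (z : ℝ) • highestRoot b := by
    rw [hroot, P.reflection_apply_root, hz]; rfl
  have hle := isNonneg_highestRoot_sub b (P.reflectionPerm (highestIndex b) i)
  have hadd := isNonneg_highestRoot_add b i
  have hfun : (fun x => ⟪P.root i, affineReflection b x⟫ + k) =
      fun x => ⟪P.root (P.reflectionPerm (highestIndex b) i), x⟫ + ((k + z : ℤ) : ℝ) := by
    funext x
    rw [inner_root_affineReflection, hroot, hz]
    push_cast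
    ring
  have hpos0 : IsNonneg b (highestRoot b) := by
    obtain ⟨j, hj⟩ := exists_root_eq_neg (P := P) (highestIndex b)
    have := (isNonneg_highestRoot_sub b j)
    rw [hj] at this
    have h2 : highestRoot b = (1 / 2 : ℝ) • (highestRoot b - -P.root (highestIndex b)) := by
      change highestRoot b = (1 / 2 : ℝ) • (highestRoot b - -highestRoot b)
      module
    rw [h2]
    exact this.smul (by norm_num)
  by_cases hneg : P.root i = -highestRoot b
  · have hz2 : z = -2 := by
      have : P.pairing i (highestIndex b) = -2 := by
        rw [← inner_root_coroot, hneg, inner_neg_left]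
        change -⟪P.root (highestIndex b), _⟫ = _
        rw [inner_root_coroot, P.pairing_same]
      rw [hz] at this
      exact_mod_cast this
    rcases hk with hk | ⟨rfl, hk⟩
    · rcases eq_or_lt_of_le (show 1 ≤ k from hk) with rfl | hk2
      · left
        funext x
        rw [hneg, inner_neg_left]
        simp only [simpleAffineRoot]
        push_cast
        ring
      · right
        refine ⟨_, k + z, ?_, hfun⟩
        rcases eq_or_lt_of_le (show 2 ≤ k from hk2) with rfl | hk3
        · refine Or.inr ⟨by rw [hz2]; rfl, ?_⟩
          rw [hroot', hneg, hz2]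
          convert hpos0 using 1
          push_cast
          module
        · left; omega
    · rw [hneg] at hk
      exact absurd (hpos0.eq_zero hk) (P.ne_zero _)
  · right
    refine ⟨_, k + z, ?_, hfun⟩
    rw [hroot'] at hle ⊢
    have hz1 : -1 ≤ z := by
      by_contra! hlt
      have hc : (0 : ℝ) ≤ -z - 2 := by
        have : (z : ℝ) ≤ -2 := by exact_mod_cast (by omega : z ≤ -2)
        linarith
      -- Adding `(-z - 2)ξ ≥ 0` to `ξ - (α - zξ) ≥ 0` gives `-(ξ + α) ≥ 0`, so `α = -ξ`.
      refine hneg (add_eq_zero_iff_eq_neg'.mp (hadd.eq_zero ?_))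
      convert hle.add (hpos0.smul hc) using 1
      module
    rcases hk with hk | ⟨rfl, hk⟩
    · rcases eq_or_lt_of_le hz1 with rfl | hz1
      · rcases eq_or_lt_of_le (show 1 ≤ k from hk) with rfl | hk2
        · refine Or.inr ⟨rfl, ?_⟩
          convert hadd using 1
          push_cast
          module
        · left; omega
      · left; omega
    -- If `z = -1`, then `α + ξ` is a root below `ξ`, so the positive root `α` would satisfy `-α ≥
    -- 0`.
    · have hz0 : 0 ≤ z := by
        by_contra! hlt
        obtain rfl : z = -1 := by omega
        have h0 := hk.eq_zero (by convert hle using 1; push_cast; module)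
        exact P.ne_zero _ h0
      rcases eq_or_lt_of_le hz0 with rfl | hz0
      · exact Or.inr ⟨rfl, by simpa using hk⟩
      · left; omega

lemma generator_pos (i : Option b.support) {g : V n → ℝ}
    (hg : g ∈ positiveAffineRoots b) :
    g = simpleAffineRoot b i ∨ (fun x => g (generator b i x)) ∈ positiveAffineRoots b := by
  cases i with
  | none => exact affineReflection_pos b hg
  | some i =>
    obtain ⟨j, k, hk, rfl⟩ := hg
    have hfun : (fun x => ⟪P.root j, generator b (some i) x⟫ + k) =
        fun x => ⟪P.root (P.reflectionPerm i j), x⟫ + (k : ℝ) := by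
      funext x
      rw [P.root_reflectionPerm, P.reflection_apply_root]
      change ⟪P.root j, P.reflection i x⟫ + (k : ℝ) = _
      rw [reflection_eq_sub, inner_sub_right, inner_smul_right, inner_root_coroot, inner_sub_left,
        inner_smul_left]
      simp only [conj_trivial]
      ring
    by_cases hj : k = 0 ∧ P.root j = P.root i
    · left
      funext x
      simp [hj.1, hj.2, simpleAffineRoot]
    · right
      refine ⟨_, k, hk.imp_right fun h => ⟨h.1, ?_⟩, hfun⟩
      rw [P.root_reflectionPerm]
      exact isNonneg_reflection h.2 fun h' => hj ⟨h.1, h'⟩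

/-- For `k ≥ 1`, `⟪α, a⟫ + k ≥ 1 - ⟪ξ, a⟫ = y₀ ≥ 0`. -/
lemma nonneg_of_mem_fundDomain {a : V n} (ha : a ∈ fundDomain b) {g : V n → ℝ}
    (hg : g ∈ positiveAffineRoots b) : 0 ≤ g a := by
  obtain ⟨y₀, y, hy₀, hy, hsum, rfl⟩ := ha
  have hinner : ∀ v : V n, ⟪v, ∑ i, y i • fundCoweight b i⟫ =
      ∑ i, y i * b.toWeightBasis.repr v i := by
    intro v
    classical
    rw [inner_eq_sum_repr (b := b)]
    simp only [inner_sum, inner_smul_right, inner_root_fundCoweight]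
    simp [mul_comm]
  have hnn : ∀ v : V n, IsNonneg b v → 0 ≤ ⟪v, ∑ i, y i • fundCoweight b i⟫ := fun v hv => by
    rw [hinner]
    exact Finset.sum_nonneg fun i _ => mul_nonneg (hy i) (hv i)
  obtain ⟨i, k, hk | ⟨rfl, hk⟩, rfl⟩ := hg
  · have h1 := hnn _ (isNonneg_highestRoot_add b i)
    rw [inner_add_left] at h1
    have h2 := hinner (highestRoot b)
    change _ = ∑ i, y i * mark b i at h2
    have h3 : (1 : ℝ) ≤ k := by exact_mod_cast hk
    change 0 ≤ ⟪P.root i, _⟫ + (k : ℝ)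
    linarith
  · simpa using hnn _ hk

end Positive

/-! ### Isometry and integrality -/

lemma inner_weylGroup [IsEuclidean P] {b : P.Base} {A : V n ≃ₗ[ℝ] V n} (hA : A ∈ weylGroup b)
    (x y : V n) : ⟪A x, A y⟫ = ⟪x, y⟫ := by
  induction hA using Subgroup.closure_induction generalizing x y with
  | mem A hA =>
    obtain ⟨i, rfl⟩ := hA
    have h0 := (inner_root_self_pos (P := P) i).ne'
    simp only [reflection_eq_sub, IsEuclidean.coroot_eq, inner_sub_left, inner_sub_right,
      inner_smul_left, inner_smul_right, conj_trivial]
    rw [real_inner_comm (P.root i) x]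
    field_simp
    ring
  | one => rfl
  | mul A B _ _ ihA ihB => exact (ihA (B x) (B y)).trans (ihB x y)
  | inv A _ ih =>
    rw [← ih (A⁻¹ x) (A⁻¹ y)]
    congr 1 <;> exact (A.apply_symm_apply _)

/-- Weyl group elements move an admissible dual shift by a weight. -/
lemma sub_mem_weightLattice {b : P.Base} {ρ : V n} (hρ : IsAdmissibleDualShift b ρ)
    {A : V n ≃ₗ[ℝ] V n} (hA : A ∈ weylGroup b) : A ρ - ρ ∈ weightLattice P := by
  have h : A ρ ∈ {y | ∃ p ∈ weightLattice P, y = ρ + p} := by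
    rw [← hρ]
    exact ⟨A, hA, 0, fun q _ => ⟨0, by simp⟩, by simp⟩
  obtain ⟨p, hp, h⟩ := h
  rwa [h, add_sub_cancel_left]

section

variable [Nonempty ι] [P.IsCrystallographic] [IsEuclidean P] (b : P.Base)

lemma simpleAffineRoot_int {q : V n} (hq : q ∈ P.corootSpan ℤ) (i : Option b.support) :
    ∃ z : ℤ, simpleAffineRoot b i q = z := by
  have h : ∀ j, ∃ z : ℤ, ⟪P.root j, q⟫ = z := by
    intro j
    induction hq using Submodule.span_induction with
    | mem x hx =>
      obtain ⟨k, rfl⟩ := hx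
      rw [inner_root_coroot]
      exact exists_pairing_eq_intCast j k
    | zero => exact ⟨0, by simp⟩
    | add x y _ _ hx hy =>
      obtain ⟨z, hz⟩ := hx
      obtain ⟨z', hz'⟩ := hy
      exact ⟨z + z', by rw [inner_add_right, hz, hz']; push_cast; rfl⟩
    | smul c x _ hx =>
      obtain ⟨z, hz⟩ := hx
      exact ⟨c * z, by rw [← Int.cast_smul_eq_zsmul ℝ, inner_smul_right, hz]; push_cast; rfl⟩
  cases i with
  | none =>
    obtain ⟨z, hz⟩ := h (highestIndex b)
    exact ⟨1 - z, by simp [simpleAffineRoot, highestRoot, hz]⟩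
  | some i => exact h i

lemma generator_mem_corootSpan {q : V n} (hq : q ∈ P.corootSpan ℤ) (i : Option b.support) :
    generator b i q ∈ P.corootSpan ℤ := by
  obtain ⟨z, hz⟩ := simpleAffineRoot_int b hq i
  rw [generator_apply, hz, Int.cast_smul_eq_zsmul]
  refine sub_mem hq (Submodule.smul_mem _ z ?_)
  cases i with
  | none => exact neg_mem (Submodule.subset_span ⟨_, rfl⟩)
  | some i => exact Submodule.subset_span ⟨_, rfl⟩

/-- The equivalence, rather than one implication, lets the induction pass to inverses. -/
lemma apply_mem_corootSpan_iff {w : V n ≃ᵃ[ℝ] V n} (hw : w ∈ affineWeylGroup b) (q : V n) :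
    w q ∈ P.corootSpan ℤ ↔ q ∈ P.corootSpan ℤ := by
  induction hw using Subgroup.closure_induction generalizing q with
  | mem w hw =>
    rw [← range_generator] at hw
    obtain ⟨i, rfl⟩ := hw
    refine ⟨fun h => ?_, fun h => generator_mem_corootSpan b h i⟩
    have h1 := generator_mem_corootSpan b h i
    have h2 : generator b i (generator b i q) = q :=
      congrArg (fun g : V n ≃ᵃ[ℝ] V n => g q) (generator_mul_self b i)
    rwa [h2] at h1
  | one => rfl
  | mul w w' _ _ ih ih' => exact (ih (w' q)).trans (ih' q)
  | inv w _ ih =>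
    rw [← ih (w⁻¹ q)]
    have : w (w⁻¹ q) = q := w.apply_symm_apply q
    rw [this]

lemma translationPart_mem (w : affineWeylGroup b) : translationPart b w ∈ P.corootSpan ℤ :=
  (apply_mem_corootSpan_iff b w.2 0).mpr (zero_mem _)

end

/-! ### The homomorphism `γ` and the stabilizers -/

section

variable [Finite ι] [Nonempty ι] [P.IsCrystallographic] [P.IsReduced] (b : P.Base)

lemma translationPart_mul (w w' : affineWeylGroup b) : translationPart b (w * w') =
    (retraction b w : V n ≃ₗ[ℝ] V n) (translationPart b w') + translationPart b w := by
  have h := (w : V n ≃ᵃ[ℝ] V n).map_vadd 0 (translationPart b w')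
  rw [vadd_eq_add, vadd_eq_add, add_zero] at h
  exact h

variable [IsEuclidean P] {b}

lemma shiftHom_mul {ρ : V n} (hρ : IsAdmissibleDualShift b ρ) (w w' : affineWeylGroup b) :
    shiftHom b ρ (w * w') = shiftHom b ρ w * shiftHom b ρ w' := by
  set A := retraction b w with hA
  obtain ⟨z, hz⟩ := sub_mem_weightLattice hρ (inv_mem A.2) _ (translationPart_mem b w')
  have h1 : ⟪(A : V n ≃ₗ[ℝ] V n) (translationPart b w'), ρ⟫ = ⟪translationPart b w', ρ⟫ + z := by
    rw [← hz, ← inner_weylGroup (inv_mem A.2)]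
    have h2 : (A : V n ≃ₗ[ℝ] V n)⁻¹ ((A : V n ≃ₗ[ℝ] V n) (translationPart b w')) =
      translationPart b w' := (A : V n ≃ₗ[ℝ] V n).symm_apply_apply _
    rw [h2, real_inner_comm _ (_ - ρ), inner_sub_right]
    ring
  rw [shiftHom, shiftHom, shiftHom, ← Complex.exp_add, translationPart_mul, inner_add_left, ← hA, h1,
    Complex.exp_eq_exp_iff_exists_int]
  refine ⟨z, ?_⟩
  push_cast
  ring

/-- The homomorphism `γ^σ_ρ`. -/
noncomputable def gammaHom (σ : weylGroup b →* ℤˣ) {ρ : V n} (hρ : IsAdmissibleDualShift b ρ) :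
    affineWeylGroup b →* ℂ where
  toFun := gamma b σ ρ
  map_one' := by
    have h : translationPart b 1 = 0 := rfl
    simp [gamma, shiftHom, h]
  map_mul' w w' := by
    rw [gamma, gamma, gamma, shiftHom_mul hρ, map_mul, map_mul]
    push_cast
    ring

/-- The stabilizer of a point of `F` is generated by the elements of `R` which fix this point. -/
theorem stab_subset_closure [P.IsIrreducible] {a : V n} (ha : a ∈ fundDomain b) :
    stab b a ⊆ Subgroup.closure {r : affineWeylGroup b |
      (r : V n ≃ᵃ[ℝ] V n) a = a ∧ (r : V n ≃ᵃ[ℝ] V n) ∈ generators b} := by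
  intro w hw
  have hmem : ∀ i, generator b i ∈ affineWeylGroup b := fun i =>
    Subgroup.subset_closure (range_generator b ▸ ⟨i, rfl⟩)
  let _ : MulAction (affineWeylGroup b) (V n) :=
    { smul := fun w x => (w : V n ≃ᵃ[ℝ] V n) x
      one_smul := fun _ => rfl
      mul_smul := fun _ _ _ => rfl }
  have key := mem_closure_of_smul_eq (X := V n)
    (fun i => (⟨generator b i, hmem i⟩ : affineWeylGroup b))
    (simpleAffineRoot b) (positiveAffineRoots b) ?_ ?_ (simpleAffineRoot_mem b)
    (simpleAffineRoot_generator b) (fun i g hg => generator_pos b i hg) ?_ a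
    (fun g hg => nonneg_of_mem_fundDomain b ha hg) ?_ w hw
  · refine Subgroup.closure_mono ?_ key
    rintro _ ⟨h, i, rfl⟩
    exact ⟨h, range_generator b ▸ ⟨i, rfl⟩⟩
  · refine Eq.trans (congrArg Subgroup.closure ?_)
      (Subgroup.closure_closure_coe_preimage (k := generators b))
    ext g
    change _ ↔ (g : V n ≃ᵃ[ℝ] V n) ∈ generators b
    rw [← range_generator]
    simp [Subtype.ext_iff]
  · exact fun i => Subtype.ext (generator_mul_self b i)
  · exact fun i j w h => Subtype.ext
      (generator_conj b (inner_weylGroup (linear_mem_weylGroup b w)) h)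
  · intro i hi
    change generator b i a = a
    rw [generator_apply, hi, zero_smul, sub_zero]

theorem signDomain_eq [P.IsIrreducible] (σ : weylGroup b →* ℤˣ) {ρ : V n}
    (hρ : IsAdmissibleDualShift b ρ) :
    signDomain b σ ρ = fundDomain b \ negBoundary b σ ρ := by
  have hone : gamma b σ ρ 1 = 1 := (gammaHom σ hρ).map_one
  have hmul : ∀ w w', gamma b σ ρ (w * w') = gamma b σ ρ w * gamma b σ ρ w' :=
    (gammaHom σ hρ).map_mul
  ext a
  constructor
  · rintro ⟨ha, h⟩
    refine ⟨ha, ?_⟩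
    rintro ⟨-, r, ⟨-, hr⟩, hra⟩
    have h1 : gamma b σ ρ r ∈ ({1} : Set ℂ) := h ▸ ⟨r, hra, rfl⟩
    rw [hr, Set.mem_singleton_iff] at h1
    norm_num at h1
  · rintro ⟨ha, h⟩
    refine ⟨ha, Set.Subset.antisymm ?_ ?_⟩
    · rintro _ ⟨w, hw, rfl⟩
      have hw' := stab_subset_closure ha hw
      clear hw
      rw [Set.mem_singleton_iff]
      induction hw' using Subgroup.closure_induction with
      | mem r hr =>
        obtain ⟨hra, hr⟩ := hr
        -- An involution has `γ`-value `±1`, and `-1` is excluded because `a` is not in `H`.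
        have h2 : r * r = 1 := by
          obtain ⟨i, hi⟩ := range_generator b ▸ hr
          exact Subtype.ext (by rw [Subgroup.coe_mul, ← hi, generator_mul_self]; rfl)
        have h3 : gamma b σ ρ r * gamma b σ ρ r = 1 := by rw [← hmul, h2, hone]
        exact (mul_self_eq_one_iff.mp h3).resolve_right fun h4 => h ⟨ha, r, ⟨hr, h4⟩, hra⟩
      | one => exact hone
      | mul w w' _ _ ih ih' => rw [hmul, ih, ih', one_mul]
      | inv w _ ih =>
        have h1 := hmul w w⁻¹
        rwa [mul_inv_cancel, hone, ih, one_mul, eq_comm] at h1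
    · rintro _ rfl
      exact ⟨1, rfl, hone⟩

end

end AffineWeyl

theorem mainTheorem9 {n : ℕ} {ι : Type*} [Finite ι] [Nonempty ι]
    (P : RootPairing ι ℝ (AffineWeyl.V n) (AffineWeyl.V n))
    [P.IsCrystallographic] [P.IsReduced] [P.IsIrreducible] [AffineWeyl.IsEuclidean P]
    (b : P.Base) (σ : AffineWeyl.weylGroup b →* ℤˣ) :
    (∀ ρ : AffineWeyl.V n, AffineWeyl.IsAdmissibleDualShift b ρ →
      AffineWeyl.signDomain b σ ρ =
        AffineWeyl.fundDomain b \ AffineWeyl.negBoundary b σ ρ) ∧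
    (∀ ρ' : AffineWeyl.V n, AffineWeyl.IsAdmissibleShift b ρ' →
      AffineWeyl.dualSignDomain b σ ρ' =
        AffineWeyl.dualFundDomain b \ AffineWeyl.dualNegBoundary b σ ρ') :=
  -- The dual notions unfold to those of `b.flip`, so one theorem serves both halves.
  ⟨fun _ hρ => AffineWeyl.signDomain_eq σ hρ,
    fun _ hρ => AffineWeyl.signDomain_eq (AffineWeyl.signFlip σ) hρ⟩
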